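/- Let $n\ge 2$, $\mathcal N=\{1,\dots,n\}$ and $A=[a_{i,j}]\in\mathbb C^{n\times n}$, with spectrum $\sigma(A)$. Let $\mathcal F_n$ be the set of all functions $f=(f_1,\dots,f_n):\mathbb C^{n\times n}\to[0,\infty)^n$ such that each $f_k(B)$ depends only on the moduli of the off-diagonal entries of $B$. A function $f\in\mathcal F_n$ is a $G$-function if every $B=[b_{i,j}]\in\mathbb C^{n\times n}$ with $|b_{k,k}|>f_k(B)$ for all $k\in\mathcal N$ is nonsingular. Let $\mathcal G_n$ be the set of $G$-functions. Let $g,h$ denote elements of $\mathcal G_n$ and $\alpha,\beta$ numbers in $[0,1]$; write $g_i=g_i(A)$, $h_i=h_i(A)$, and use the convention $0^0=1$. For $k=1,2,3$ and $i\in\mathcal N$ let $\check\Gamma^{(k)}_i=\{z\in\mathbb C:|z-a_{i,i}|\le\rho^{(k)}_i\}$, where - $\rho^{(1)}_i=g_i$, $\quad\rho^{(2)}_i=g_i^{\alpha}h_i^{1-\alpha}$, $\quad\rho^{(3)}_i=\alpha g_i+(1-\alpha)h_i$. For $k=4,\dots,13$ and $i\ne j$ in $\mathcal N$ let $\check\Gamma^{(k)}_{i,j}=\{z\in\mathbb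 C:|z-a_{i,i}||z-a_{j,j}|\le\rho^{(k)}_{i,j}\}$, where - $\rho^{(4)}_{i,j}=g_ig_j$, $\quad\rho^{(5)}_{i,j}=g_ih_j$, - $\rho^{(6)}_{i,j}=(g_ig_j)^{\alpha}(h_ih_j)^{1-\alpha}$, - $\rho^{(7)}_{i,j}=(g_ih_j)^{\alpha}(g_jh_i)^{1-\alpha}$, - $\rho^{(8)}_{i,j}=\alpha g_ig_j+(1-\alpha)h_ih_j$, - $\rho^{(9)}_{i,j}=\alpha g_ih_j+(1-\alpha)g_jh_i$, - $\rho^{(10)}_{i,j}=[\alpha g_i+(1-\alpha)h_i][\alpha g_j+(1-\alpha)h_j]$, - $\rho^{(11)}_{i,j}=[\alpha g_i+(1-\alpha)h_i][\alpha h_j+(1-\alpha)g_j]$, - $\rho^{(12)}_{i,j}=[\alpha g_i+(1-\alpha)h_j][\alpha g_j+(1-\alpha)h_i]$, - $\rho^{(13)}_{i,j}=[\alpha g_i+(1-\alpha)g_j][\alpha h_j+(1-\alpha)h_i]$. For $k=14,\dots,27$ and $i\ne j$ in $\mathcal N$ let $\check\Gamma^{(k)}_{i,j}=\{z\in\mathbb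 C:|z-a_{i,i}|^{\alpha}|z-a_{j,j}|^{1-\alpha}\le\rho^{(k)}_{i,j}\}$, where - $\rho^{(14)}_{i,j}=g_i^{\alpha}g_j^{1-\alpha}$, $\quad\rho^{(15)}_{i,j}=g_i^{\alpha}h_j^{1-\alpha}$, - $\rho^{(16)}_{i,j}=\alpha g_i+(1-\alpha)g_j$, $\quad\rho^{(17)}_{i,j}=\alpha g_i+(1-\alpha)h_j$, - $\rho^{(18)}_{i,j}=[g_i^{\beta}h_i^{1-\beta}]^{\alpha}[g_j^{\beta}h_j^{1-\beta}]^{1-\alpha}$, - $\rho^{(19)}_{i,j}=[g_i^{\beta}h_i^{1-\beta}]^{\alpha}[h_j^{\beta}g_j^{1-\beta}]^{1-\alpha}$, - $\rho^{(20)}_{i,j}=\beta g_i^{\alpha}g_j^{1-\alpha}+(1-\beta)h_i^{\alpha}h_j^{1-\alpha}$, - $\rho^{(21)}_{i,j}=\beta g_i^{\alpha}h_j^{1-\alpha}+(1-\beta)h_i^{\alpha}g_j^{1-\alpha}$, - $\rho^{(22)}_{i,j}=\alpha g_i^{\beta}h_i^{1-\beta}+(1-\alpha)g_j^{\beta}h_j^{1-\beta}$,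 - $\rho^{(23)}_{i,j}=\alpha g_i^{\beta}h_i^{1-\beta}+(1-\alpha)h_j^{\beta}g_j^{1-\beta}$, - $\rho^{(24)}_{i,j}=[\beta g_i+(1-\beta)h_i]^{\alpha}[\beta g_j+(1-\beta)h_j]^{1-\alpha}$, - $\rho^{(25)}_{i,j}=[\beta g_i+(1-\beta)h_i]^{\alpha}[\beta h_j+(1-\beta)g_j]^{1-\alpha}$, - $\rho^{(26)}_{i,j}=[\alpha g_i+(1-\alpha)g_j]^{\beta}[\alpha h_i+(1-\alpha)h_j]^{1-\beta}$, - $\rho^{(27)}_{i,j}=[\alpha g_i+(1-\alpha)h_j]^{\beta}[\alpha h_i+(1-\alpha)g_j]^{1-\beta}$. Let $\check\Gamma^{(k)}$ be the union of the $\check\Gamma^{(k)}_i$ over $i\in\mathcal N$ if $k\le 3$, and the union of the $\check\Gamma^{(k)}_{i,j}$ over $i,j\in\mathcal N$ with $i\ne j$ if $k\ge 4$. Each of these sets depends on $A$ and on those of $g,h,\alpha,\beta$ that occur in its definition. Let $\mathbf{\check\Gamma}^{(k)}(A,\mathcal G_n)$ be the intersection of the sets $\check\Gamma^{(k)}$ over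 all $g,h\in\mathcal G_n$ and all $\alpha,\beta\in[0,1]$ (as far as they occur). Then: (a) For all $g,h\in\mathcal G_n$, all $\alpha,\beta\in[0,1]$ and every $\lambda\in\sigma(A)$: for each $k=1,2,3$ there is $i\in\mathcal N$ with $\lambda\in\check\Gamma^{(k)}_i$, and for each $k=4,\dots,27$ there are $i,j\in\mathcal N$ with $i\ne j$ and $\lambda\in\check\Gamma^{(k)}_{i,j}$. (b) For each $k=1,\dots,27$ one has $\sigma(A)\subseteq\mathbf{\check\Gamma}^{(k)}(A,\mathcal G_n)$, and $\mathbf{\check\Gamma}^{(k)}(A,\mathcal G_n)\subseteq\check\Gamma^{(k)}$ for all $g,h\in\mathcal G_n$ and all $\alpha,\beta\in[0,1]$. (c) $\displaystyle\sigma(A)\subseteq\bigcap_{1\le k\le 27}\mathbf{\check\Gamma}^{(k)}(A,\mathcal G_n)=\mathbf{\check\Gamma}^{(15)}(A,\mathcal G_n)$. -/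

import Mathlib

namespace GFunction

/-- The vector-valued functions `f = (f₁, …, fₙ)` on complex `n × n` matrices such that every
`f_k` is real and nonnegative and depends only on the moduli of the off-diagonal entries. -/
def radiusFunctions (n : ℕ) : Set (Matrix (Fin n) (Fin n) ℂ → Fin n → ℝ) :=
  {f | (∀ A k, 0 ≤ f A k) ∧
    ∀ A B : Matrix (Fin n) (Fin n) ℂ, (∀ i j, i ≠ j → ‖A i j‖ = ‖B i j‖) → ∀ k, f A k = f B k}

/-- The set of `G`-functions: `|a_{kk}| > f_k(A)` for all `k` implies that `A` is nonsingular. -/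
def gFunctions (n : ℕ) : Set (Matrix (Fin n) (Fin n) ℂ → Fin n → ℝ) :=
  {f | f ∈ radiusFunctions n ∧
    ∀ A : Matrix (Fin n) (Fin n) ℂ, (∀ k, f A k < ‖A k k‖) → A.det ≠ 0}

/-- The radii of the disks of types `1, 2, 3`; the vectors `g`, `h` stand for `g(A)`, `h(A)`.
Powers are real powers, with `0 ^ 0 = 1`. Other values of `k` are never used. -/
noncomputable def diskRadius {n : ℕ} (k : ℕ) (g h : Fin n → ℝ) (α : ℝ) (i : Fin n) : ℝ :=
  match k with
  | 1 => g i
  | 2 => g i ^ α * h i ^ (1 - α)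
  | 3 => α * g i + (1 - α) * h i
  | _ => 0

/-- The right-hand sides of the ovals of types `4, …, 27`; the vectors `g`, `h` stand for
`g(A)`, `h(A)`. Powers are real powers, with `0 ^ 0 = 1`. Other values of `k` are never used. -/
noncomputable def ovalRadius {n : ℕ} (k : ℕ) (g h : Fin n → ℝ) (α β : ℝ) (i j : Fin n) : ℝ :=
  match k with
  | 4 => g i * g j
  | 5 => g i * h j
  | 6 => (g i * g j) ^ α * (h i * h j) ^ (1 - α)
  | 7 => (g i * h j) ^ α * (g j * h i) ^ (1 - α)
  | 8 => α * (g i * g j) + (1 - α) * (h i * h j)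
  | 9 => α * (g i * h j) + (1 - α) * (g j * h i)
  | 10 => (α * g i + (1 - α) * h i) * (α * g j + (1 - α) * h j)
  | 11 => (α * g i + (1 - α) * h i) * (α * h j + (1 - α) * g j)
  | 12 => (α * g i + (1 - α) * h j) * (α * g j + (1 - α) * h i)
  | 13 => (α * g i + (1 - α) * g j) * (α * h j + (1 - α) * h i)
  | 14 => g i ^ α * g j ^ (1 - α)
  | 15 => g i ^ α * h j ^ (1 - α)
  | 16 => α * g i + (1 - α) * g j
  | 17 => α * g i + (1 - α) * h j
  | 18 => (g i ^ β * h i ^ (1 - β)) ^ α * (g j ^ β * h j ^ (1 - β)) ^ (1 - α)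
  | 19 => (g i ^ β * h i ^ (1 - β)) ^ α * (h j ^ β * g j ^ (1 - β)) ^ (1 - α)
  | 20 => β * (g i ^ α * g j ^ (1 - α)) + (1 - β) * (h i ^ α * h j ^ (1 - α))
  | 21 => β * (g i ^ α * h j ^ (1 - α)) + (1 - β) * (h i ^ α * g j ^ (1 - α))
  | 22 => α * (g i ^ β * h i ^ (1 - β)) + (1 - α) * (g j ^ β * h j ^ (1 - β))
  | 23 => α * (g i ^ β * h i ^ (1 - β)) + (1 - α) * (h j ^ β * g j ^ (1 - β))
  | 24 => (β * g i + (1 - β) * h i) ^ α * (β * g j + (1 - β) * h j) ^ (1 - α)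
  | 25 => (β * g i + (1 - β) * h i) ^ α * (β * h j + (1 - β) * g j) ^ (1 - α)
  | 26 => (α * g i + (1 - α) * g j) ^ β * (α * h i + (1 - α) * h j) ^ (1 - β)
  | 27 => (α * g i + (1 - α) * h j) ^ β * (α * h i + (1 - α) * g j) ^ (1 - β)
  | _ => 0

/-- The `i`-th disk of type `k ∈ {1, 2, 3}`. -/
def disk {n : ℕ} (k : ℕ) (A : Matrix (Fin n) (Fin n) ℂ)
    (g h : Matrix (Fin n) (Fin n) ℂ → Fin n → ℝ) (α : ℝ) (i : Fin n) : Set ℂ :=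
  {z | ‖z - A i i‖ ≤ diskRadius k (g A) (h A) α i}

/-- The `(i, j)`-th oval of type `k`: a Cassini oval for `4 ≤ k ≤ 13`, and a generalized
(weighted) oval for `14 ≤ k ≤ 27`. -/
def oval {n : ℕ} (k : ℕ) (A : Matrix (Fin n) (Fin n) ℂ)
    (g h : Matrix (Fin n) (Fin n) ℂ → Fin n → ℝ) (α β : ℝ) (i j : Fin n) : Set ℂ :=
  if k ≤ 13 then
    {z | ‖z - A i i‖ * ‖z - A j j‖ ≤ ovalRadius k (g A) (h A) α β i j}
  else
    {z | ‖z - A i i‖ ^ α * ‖z - A j j‖ ^ (1 - α) ≤ ovalRadius k (g A) (h A) α β i j}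

/-- The region of type `k`: the union of all its disks (`k ≤ 3`) or of all its ovals with
`i ≠ j` (`k ≥ 4`). A type whose formula does not mention one of `h`, `α`, `β` is constant in it. -/
def region {n : ℕ} (k : ℕ) (A : Matrix (Fin n) (Fin n) ℂ)
    (g h : Matrix (Fin n) (Fin n) ℂ → Fin n → ℝ) (α β : ℝ) : Set ℂ :=
  if k ≤ 3 then ⋃ i : Fin n, disk k A g h α i
  else ⋃ (i : Fin n) (j : Fin n) (_ : i ≠ j), oval k A g h α β i j

/-- The minimal set of type `k`: the intersection of its regions over all `G`-functions and all
parameters in `[0, 1]`. Where the region of type `k` is constant in one of `h`, `α`, `β`,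
intersecting over that variable as well does not change the set. -/
def minimalSet {n : ℕ} (k : ℕ) (A : Matrix (Fin n) (Fin n) ℂ) : Set ℂ :=
  ⋂ (g ∈ gFunctions n) (h ∈ gFunctions n) (α ∈ Set.Icc (0 : ℝ) 1) (β ∈ Set.Icc (0 : ℝ) 1),
    region k A g h α β

end GFunction

/-! Type 15 controls every other type, so the work is to show that an eigenvalue satisfies the type
15 inequality for all `g`, `h`, `α`.

A `G`-function sees only off-diagonal moduli, so it also controls the real comparison matrices of
`A`. A continuity argument turns their nonsingularity into a positive weight vector for which the
weighted off-diagonal row sums are at most `g A + ε` (`offDiagDominated_of_mem_gFunctions`).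
Dominating vectors are stable under weighted geometric means, by Hölder, and each gives a
Brauer-type criterion. Given the strict mixed inequalities for `G` and `H`, either their geometric
mean lies below the diagonal everywhere, or it fails at some index and then `G` or `H` alone
satisfies Brauer's condition (`OffDiagDominated.det_ne_zero_of_rpow`). Letting `ε` be small and
applying this to `z - A` gives type 15.

The other types use type 15 with `α = 1`, `α = 1 / 2` or the given `α`, for means of `g` and `h`,
which are again `G`-functions; AM-GM enlarges the radii where needed. -/

namespace GFunction

open Finset Matrix

/-! ### Weighted diagonal dominance and nonsingularity -/

section Domination

variable {ι : Type*} [Fintype ι] [DecidableEq ι]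

/-- The off-diagonal row sums of `A`, weighted by some positive vector, are at most `G`. -/
def OffDiagDominated (A : Matrix ι ι ℂ) (G : ι → ℝ) : Prop :=
  ∃ u : ι → ℝ, (∀ k, 0 < u k) ∧ ∀ k, ∑ j ∈ univ.erase k, ‖A k j‖ * u j ≤ G k * u k

/-- The real matrix with diagonal `d` and off-diagonal entries `-‖A i j‖`. -/
noncomputable def comparison (A : Matrix ι ι ℂ) (d : ι → ℝ) : Matrix ι ι ℝ :=
  fun i j => if i = j then d i else -‖A i j‖

lemma comparison_mulVec (A : Matrix ι ι ℂ) (d u : ι → ℝ) (k : ι) :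
    (comparison A d *ᵥ u) k = d k * u k - ∑ j ∈ univ.erase k, ‖A k j‖ * u j := by
  rw [mulVec, dotProduct, ← Finset.add_sum_erase _ _ (mem_univ k)]
  have h : ∑ j ∈ univ.erase k, comparison A d k j * u j
      = -∑ j ∈ univ.erase k, ‖A k j‖ * u j := by
    rw [← Finset.sum_neg_distrib]
    refine Finset.sum_congr rfl fun j hj => ?_
    simp [comparison, (Finset.ne_of_mem_erase hj).symm]
  rw [h]
  simp [comparison, sub_eq_add_neg]

/-- If all comparison matrices with diagonal at least `G` are nonsingular, then `G` dominates. -/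
theorem offDiagDominated_of_det_ne_zero (A : Matrix ι ι ℂ) (G : ι → ℝ) (hG : ∀ k, 0 < G k)
    (hdet : ∀ d : ι → ℝ, (∀ k, G k ≤ d k) → (comparison A d).det ≠ 0) :
    OffDiagDominated A G := by
  rcases isEmpty_or_nonempty ι with hι | hι
  · exact ⟨fun _ => 1, fun k => isEmptyElim k, fun k => isEmptyElim k⟩
  let N : ℝ → Matrix ι ι ℝ := fun t => comparison A (fun k => G k + t)
  let u : ℝ → ι → ℝ := fun t => (N t)⁻¹ *ᵥ (fun _ => 1)
  have hN : ∀ t, 0 ≤ t → (N t).det ≠ 0 := fun t ht => hdet _ fun k => by linarith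
  have hu : ∀ t, 0 ≤ t → ∀ k,
      (G k + t) * u t k = 1 + ∑ j ∈ univ.erase k, ‖A k j‖ * u t j := by
    intro t ht k
    have h1 : N t *ᵥ u t = fun _ => 1 := by
      simp only [u, mulVec_mulVec]
      rw [Matrix.mul_nonsing_inv _ (isUnit_iff_ne_zero.mpr (hN t ht)), one_mulVec]
    have h2 := comparison_mulVec A (fun k => G k + t) (u t) k
    have h3 := congrFun h1 k
    simp only [N] at h3
    rw [h3] at h2
    linarith
  have hcont : ∀ T, ∀ k, ContinuousOn (fun t => u t k) (Set.Icc 0 T) := by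
    intro T k
    have hNc : Continuous N := by
      refine continuous_matrix fun i j => ?_
      by_cases h : i = j
      · simp only [N, comparison, h, if_true]; fun_prop
      · simp only [N, comparison, h, if_false]; fun_prop
    have hadj : Continuous fun t => ((N t).adjugate *ᵥ (fun _ => (1 : ℝ))) k :=
      (continuous_apply k).comp (hNc.matrix_adjugate.matrix_mulVec continuous_const)
    have : (fun t => u t k) =
        fun t => (N t).det⁻¹ * ((N t).adjugate *ᵥ (fun _ => (1 : ℝ))) k := by
      funext t
      simp [u, Matrix.inv_def, Matrix.smul_mulVec]
    rw [this]
    exact (hNc.matrix_det.continuousOn.inv₀ fun t ht => hN t ht.1).mul hadj.continuousOn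
  -- Homotopy in the diagonal shift: the least entry of `u t` is nonnegative for large `t`, and it
  -- cannot vanish on the way down to `t = 0`, because a nonnegative `u t` is strictly positive.
  let φ : ℝ → ℝ := fun t => univ.inf' univ_nonempty (u t)
  have hφ : ∀ t, 0 ≤ t → 0 ≤ φ t → ∀ k, 0 < u t k := by
    intro t ht h0 k
    have hnn : ∀ j, 0 ≤ u t j := fun j => h0.trans (Finset.inf'_le _ (mem_univ j))
    have hs : 0 ≤ ∑ j ∈ univ.erase k, ‖A k j‖ * u t j :=
      Finset.sum_nonneg fun j _ => mul_nonneg (norm_nonneg _) (hnn j)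
    have h1 := hu t ht k
    have h2 : 0 < G k + t := by linarith [hG k]
    by_contra hneg
    have : (G k + t) * u t k ≤ 0 := mul_nonpos_of_nonneg_of_nonpos h2.le (not_lt.mp hneg)
    linarith
  -- This shift bounds every row sum, so a negative least entry of `u T` would contradict its own
  -- row equation.
  let T : ℝ := ∑ k, ∑ j ∈ univ.erase k, ‖A k j‖
  have hrow : ∀ k, ∑ j ∈ univ.erase k, ‖A k j‖ ≤ T := fun k =>
    Finset.single_le_sum (f := fun k => ∑ j ∈ univ.erase k, ‖A k j‖)
      (fun i _ => Finset.sum_nonneg fun j _ => norm_nonneg _) (mem_univ k)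
  have hT : 0 ≤ T := Finset.sum_nonneg fun i _ => Finset.sum_nonneg fun j _ => norm_nonneg _
  have hφT : 0 ≤ φ T := by
    obtain ⟨k, -, hk⟩ := Finset.exists_mem_eq_inf' univ_nonempty (u T)
    have hmin : ∀ j, u T k ≤ u T j := fun j => hk ▸ Finset.inf'_le _ (mem_univ j)
    change 0 ≤ univ.inf' univ_nonempty (u T)
    rw [hk]
    by_contra hneg
    push Not at hneg
    have h1 := hu T hT k
    have h2 : (∑ j ∈ univ.erase k, ‖A k j‖) * u T k ≤ ∑ j ∈ univ.erase k, ‖A k j‖ * u T j := by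
      rw [Finset.sum_mul]
      exact Finset.sum_le_sum fun j _ => mul_le_mul_of_nonneg_left (hmin j) (norm_nonneg _)
    nlinarith [hrow k, hG k, mul_nonneg (sub_nonneg.mpr (hrow k)) (neg_nonneg.mpr hneg.le),
      mul_pos (hG k) (neg_pos.mpr hneg)]
  have hφ0 : 0 ≤ φ 0 := by
    by_contra hneg
    push Not at hneg
    have hc : ContinuousOn φ (Set.Icc 0 T) :=
      ContinuousOn.finset_inf'_apply univ_nonempty fun k _ => hcont T k
    obtain ⟨t, ht, h0⟩ := intermediate_value_Icc hT hc ⟨hneg.le, hφT⟩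
    obtain ⟨k, -, hk⟩ := Finset.exists_mem_eq_inf' univ_nonempty (u t)
    have hpos := hφ t ht.1 h0.ge k
    rw [← hk] at hpos
    exact hpos.ne' h0
  refine ⟨u 0, hφ 0 le_rfl hφ0, fun k => ?_⟩
  have := hu 0 le_rfl k
  rw [add_zero] at this
  linarith

/-- Nonsingularity criterion of Brauer type with respect to a dominating vector. -/
theorem OffDiagDominated.det_ne_zero [Nontrivial ι] {A : Matrix ι ι ℂ} {G : ι → ℝ}
    (hA : OffDiagDominated A G) (hG : ∀ k, 0 < G k)
    (hlt : ∀ i j, i ≠ j → G i * G j < ‖A i i‖ * ‖A j j‖) : A.det ≠ 0 := by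
  intro hdet
  obtain ⟨y, hy0, hy⟩ := Matrix.exists_mulVec_eq_zero_iff.mpr hdet
  obtain ⟨u, hu, hGu⟩ := hA
  let t : ι → ℝ := fun k => ‖y k‖ / u k
  have htn : ∀ k, 0 ≤ t k := fun k => div_nonneg (norm_nonneg _) (hu k).le
  have hyt : ∀ k, ‖y k‖ = t k * u k := fun k => (div_mul_cancel₀ _ (hu k).ne').symm
  have hrow : ∀ k, ∀ r : ℝ, 0 ≤ r → (∀ j, j ≠ k → t j ≤ r) → ‖A k k‖ * t k ≤ G k * r := by
    intro k r hr hle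
    have h1 := congrFun hy k
    rw [mulVec, dotProduct, ← Finset.add_sum_erase _ _ (mem_univ k), Pi.zero_apply] at h1
    have h2 : ‖A k k‖ * ‖y k‖ ≤ ∑ j ∈ univ.erase k, ‖A k j‖ * ‖y j‖ := by
      rw [← norm_mul, eq_neg_of_add_eq_zero_left h1, norm_neg]
      exact (norm_sum_le _ _).trans (Finset.sum_le_sum fun j _ => (norm_mul _ _).le)
    have h3 : ∑ j ∈ univ.erase k, ‖A k j‖ * ‖y j‖
        ≤ r * ∑ j ∈ univ.erase k, ‖A k j‖ * u j := by
      rw [Finset.mul_sum]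
      refine Finset.sum_le_sum fun j hj => ?_
      rw [hyt j]
      have := mul_le_mul_of_nonneg_right (hle j (Finset.ne_of_mem_erase hj))
        (mul_nonneg (norm_nonneg (A k j)) (hu j).le)
      linarith
    have h4 := mul_le_mul_of_nonneg_left (hGu k) hr
    rw [hyt k] at h2
    refine le_of_mul_le_mul_right ?_ (hu k)
    linarith
  -- Brauer's argument: take the rows of the two largest scaled entries of the null vector and
  -- multiply their estimates.
  obtain ⟨i, -, hi⟩ := Finset.exists_max_image univ t univ_nonempty
  obtain ⟨j₀, hj₀⟩ := exists_ne i
  obtain ⟨j, hj, hjmax⟩ := Finset.exists_max_image (univ.erase i) t ⟨j₀, by simp [hj₀]⟩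
  have hji : j ≠ i := Finset.ne_of_mem_erase hj
  have h1 := hrow i (t j) (htn j) fun k hk => hjmax k (by simp [hk])
  have h2 := hrow j (t i) (htn i) fun k _ => hi k (mem_univ k)
  have hti : 0 < t i := by
    obtain ⟨k, hk⟩ := Function.ne_iff.mp hy0
    exact lt_of_lt_of_le (div_pos (norm_pos_iff.mpr hk) (hu k)) (hi k (mem_univ k))
  have hlt' := hlt i j hji.symm
  have hpos : 0 < ‖A i i‖ * ‖A j j‖ := (mul_pos (hG i) (hG j)).trans hlt'
  have hAi : 0 < ‖A i i‖ := pos_of_mul_pos_left hpos (norm_nonneg _)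
  have htj : 0 < t j := by
    have : 0 < G i * t j := (mul_pos hAi hti).trans_le h1
    exact pos_of_mul_pos_right this (hG i).le
  have h3 := mul_le_mul h1 h2 (mul_nonneg (norm_nonneg _) htj.le) (mul_nonneg (hG i).le htj.le)
  have h4 := mul_lt_mul_of_pos_right hlt' (mul_pos hti htj)
  linarith

/-- Hölder's inequality in each row, with the geometric mean of the two weight vectors as the new
weight. -/
theorem OffDiagDominated.rpow_mul_rpow {A : Matrix ι ι ℂ} {G H : ι → ℝ}
    (hAG : OffDiagDominated A G) (hAH : OffDiagDominated A H)
    (hG : ∀ k, 0 < G k) (hH : ∀ k, 0 < H k) {α : ℝ} (hα : α ∈ Set.Icc (0 : ℝ) 1) :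
    OffDiagDominated A (fun k => G k ^ α * H k ^ (1 - α)) := by
  obtain ⟨u, hu, hGu⟩ := hAG
  obtain ⟨v, hv, hHv⟩ := hAH
  refine ⟨fun k => u k ^ α * v k ^ (1 - α), fun k => mul_pos (Real.rpow_pos_of_pos (hu k) _)
    (Real.rpow_pos_of_pos (hv k) _), fun k => ?_⟩
  have hU := mul_pos (hG k) (hu k)
  have hV := mul_pos (hH k) (hv k)
  set U := G k * u k
  set V := H k * v k
  have hUV : G k ^ α * H k ^ (1 - α) * (u k ^ α * v k ^ (1 - α)) = U ^ α * V ^ (1 - α) := by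
    rw [Real.mul_rpow (hG k).le (hu k).le, Real.mul_rpow (hH k).le (hv k).le]
    ring
  have hUVpos : 0 < U ^ α * V ^ (1 - α) :=
    mul_pos (Real.rpow_pos_of_pos hU _) (Real.rpow_pos_of_pos hV _)
  rw [hUV]
  -- Dividing by `U` and `V` before AM-GM makes the resulting row sum at most `α + (1 - α) = 1`.
  have hterm : ∀ j ∈ univ.erase k, ‖A k j‖ * (u j ^ α * v j ^ (1 - α)) ≤
      U ^ α * V ^ (1 - α) * (α / U * (‖A k j‖ * u j) + (1 - α) / V * (‖A k j‖ * v j)) := by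
    intro j _
    have h := Real.geom_mean_le_arith_mean2_weighted hα.1 (sub_nonneg.mpr hα.2)
      (div_pos (hu j) hU).le (div_pos (hv j) hV).le (by ring)
    rw [Real.div_rpow (hu j).le hU.le, Real.div_rpow (hv j).le hV.le, div_mul_div_comm,
      div_le_iff₀ hUVpos] at h
    have := mul_le_mul_of_nonneg_left h (norm_nonneg (A k j))
    calc _ ≤ _ := this
      _ = _ := by ring
  refine (Finset.sum_le_sum hterm).trans ?_
  rw [← Finset.mul_sum, Finset.sum_add_distrib, ← Finset.mul_sum, ← Finset.mul_sum]
  refine mul_le_of_le_one_right hUVpos.le ?_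
  have h1 := mul_le_mul_of_nonneg_left (hGu k) (div_nonneg hα.1 hU.le)
  have h2 := mul_le_mul_of_nonneg_left (hHv k) (div_nonneg (sub_nonneg.mpr hα.2) hV.le)
  rw [div_mul_cancel₀ _ hU.ne'] at h1
  rw [div_mul_cancel₀ _ hV.ne'] at h2
  linarith

/-- Two dominating vectors satisfying the weighted mixed inequalities force nonsingularity. -/
theorem OffDiagDominated.det_ne_zero_of_rpow [Nontrivial ι] {A : Matrix ι ι ℂ} {G H : ι → ℝ}
    (hAG : OffDiagDominated A G) (hAH : OffDiagDominated A H)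
    (hG : ∀ k, 0 < G k) (hH : ∀ k, 0 < H k) {α : ℝ} (hα : α ∈ Set.Icc (0 : ℝ) 1)
    (hlt : ∀ i j, i ≠ j → G i ^ α * H j ^ (1 - α) < ‖A i i‖ ^ α * ‖A j j‖ ^ (1 - α)) :
    A.det ≠ 0 := by
  by_cases hdiag : ∀ i, G i ^ α * H i ^ (1 - α) < ‖A i i‖
  · have hpos : ∀ k, 0 < G k ^ α * H k ^ (1 - α) := fun k =>
      mul_pos (Real.rpow_pos_of_pos (hG k) _) (Real.rpow_pos_of_pos (hH k) _)
    exact (hAG.rpow_mul_rpow hAH hG hH hα).det_ne_zero hpos fun i j _ =>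
      mul_lt_mul'' (hdiag i) (hdiag j) (hpos i).le (hpos j).le
  push Not at hdiag
  obtain ⟨i, hi⟩ := hdiag
  -- At an endpoint the mixed inequality involves one index only, and applied at `i` it contradicts
  -- `hi`. For `0 < α < 1` the diagonal entries are nonzero and logarithms are available.
  rcases hα.1.eq_or_lt with h0 | h0
  · subst h0
    obtain ⟨j, hj⟩ := exists_ne i
    have := hlt j i hj
    simp at this hi
    linarith
  rcases hα.2.eq_or_lt with h1 | h1
  · subst h1
    obtain ⟨j, hj⟩ := exists_ne i
    have := hlt i j hj.symm
    simp at this hi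
    linarith
  have h1' : 0 < 1 - α := sub_pos.mpr h1
  have hGH : ∀ k l, 0 < G k ^ α * H l ^ (1 - α) := fun k l =>
    mul_pos (Real.rpow_pos_of_pos (hG k) _) (Real.rpow_pos_of_pos (hH l) _)
  have hx : ∀ k, 0 < ‖A k k‖ := by
    intro k
    obtain ⟨j, hj⟩ := exists_ne k
    refine (norm_nonneg _).lt_of_ne' fun hzero => ?_
    have := hlt k j hj.symm
    rw [hzero, Real.zero_rpow h0.ne', zero_mul] at this
    exact absurd this (hGH k j).not_gt
  have hlog : ∀ p q : ℝ, 0 < p → 0 < q →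
      Real.log (p ^ α * q ^ (1 - α)) = α * Real.log p + (1 - α) * Real.log q := fun p q hp hq => by
    rw [Real.log_mul (Real.rpow_pos_of_pos hp _).ne' (Real.rpow_pos_of_pos hq _).ne',
      Real.log_rpow hp, Real.log_rpow hq]
  let a : ι → ℝ := fun k => Real.log (G k) - Real.log ‖A k k‖
  let b : ι → ℝ := fun k => Real.log (H k) - Real.log ‖A k k‖
  have hab : ∀ k l, k ≠ l → α * a k + (1 - α) * b l < 0 := by
    intro k l hkl
    have := Real.log_lt_log (hGH k l) (hlt k l hkl)
    rw [hlog _ _ (hG k) (hH l), hlog _ _ (hx k) (hx l)] at this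
    simp only [a, b]
    linarith
  have hii : 0 ≤ α * a i + (1 - α) * b i := by
    have := Real.log_le_log (hx i) hi
    rw [hlog _ _ (hG i) (hH i)] at this
    simp only [a, b]
    linarith
  have key : ∀ F : ι → ℝ, (∀ k, 0 < F k) → OffDiagDominated A F →
      (∀ k l, k ≠ l →
        (Real.log (F k) - Real.log ‖A k k‖) + (Real.log (F l) - Real.log ‖A l l‖) < 0) →
      A.det ≠ 0 := by
    intro F hF hAF h
    refine hAF.det_ne_zero hF fun k l hkl => ?_
    rw [← Real.log_lt_log_iff (mul_pos (hF k) (hF l)) (mul_pos (hx k) (hx l)),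
      Real.log_mul (hF k).ne' (hF l).ne', Real.log_mul (hx k).ne' (hx l).ne']
    linarith [h k l hkl]
  have pairs : ∀ c : ι → ℝ, (∀ j, j ≠ i → c j < 0) → (∀ j, j ≠ i → c i + c j < 0) →
      ∀ k l, k ≠ l → c k + c l < 0 := by
    intro c hc hci k l hkl
    by_cases hk : k = i
    · subst hk; exact hci l hkl.symm
    by_cases hl : l = i
    · subst hl; rw [add_comm]; exact hci k hk
    exact add_neg (hc k hk) (hc l hl)
  -- Keep the vector with the smaller weighted log-excess at `i`. The larger excess is nonnegative
  -- by `hii`, so `hab` makes the kept excess negative away from `i`; replacing the larger by the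
  -- smaller in `hab` handles the pairs containing `i`.
  rcases le_total ((1 - α) * b i) (α * a i) with hle | hle
  · refine key H hH hAH (pairs b (fun j hj => ?_) fun j hj => ?_)
    · have := hab i j hj.symm
      by_contra hn
      nlinarith [mul_nonneg h1'.le (not_lt.mp hn)]
    · have := hab i j hj.symm
      have : (1 - α) * (b i + b j) < 0 := by linarith
      by_contra hn
      exact absurd (mul_nonneg h1'.le (not_lt.mp hn)) (not_le.mpr this)
  · refine key G hG hAG (pairs a (fun j hj => ?_) fun j hj => ?_)
    · have := hab j i hj
      by_contra hn
      nlinarith [mul_nonneg h0.le (not_lt.mp hn)]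
    · have := hab j i hj
      have : α * (a i + a j) < 0 := by linarith
      by_contra hn
      exact absurd (mul_nonneg h0.le (not_lt.mp hn)) (not_le.mpr this)

end Domination

end GFunction
-- Closure properties of `G`-functions
namespace GFunction

open Finset Matrix Filter Topology

variable {n : ℕ} {g h : Matrix (Fin n) (Fin n) ℂ → Fin n → ℝ} {α β : ℝ}

lemma gFunctions_nonneg (hg : g ∈ gFunctions n) (A : Matrix (Fin n) (Fin n) ℂ) (k : Fin n) :
    0 ≤ g A k := hg.1.1 A k

/-- The comparison matrices share the off-diagonal moduli of `A`, so `g` takes the same value on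
them. The `ε` supplies strictness, and positivity where `g A k = 0`. -/
theorem offDiagDominated_of_mem_gFunctions (hg : g ∈ gFunctions n)
    (A : Matrix (Fin n) (Fin n) ℂ) {ε : ℝ} (hε : 0 < ε) :
    OffDiagDominated A (fun k => g A k + ε) := by
  refine offDiagDominated_of_det_ne_zero A _
    (fun k => add_pos_of_nonneg_of_pos (gFunctions_nonneg hg A k) hε) fun d hd hdet => ?_
  let B : Matrix (Fin n) (Fin n) ℂ := (comparison A d).map Complex.ofRealHom
  have hgB : ∀ k, g B k = g A k := hg.1.2 B A fun i j hij => by simp [B, comparison, hij]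
  refine hg.2 B (fun k => ?_) ?_
  · have h1 : B k k = (d k : ℂ) := by simp [B, comparison]
    have h2 := hd k
    have h3 := gFunctions_nonneg hg A k
    rw [hgB, h1, Complex.norm_real, Real.norm_of_nonneg (by linarith)]
    linarith
  · have : B.det = Complex.ofRealHom (comparison A d).det :=
      (RingHom.map_det Complex.ofRealHom (comparison A d)).symm
    rw [this, hdet, map_zero]

lemma tendsto_rpow_add_mul (hα : α ∈ Set.Icc (0 : ℝ) 1) (a b : ℝ) :
    Tendsto (fun ε : ℝ => (a + ε) ^ α * (b + ε) ^ (1 - α)) (𝓝[>] 0)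
      (𝓝 (a ^ α * b ^ (1 - α))) := by
  have hc : Continuous fun ε : ℝ => (a + ε) ^ α * (b + ε) ^ (1 - α) :=
    ((Real.continuous_rpow_const hα.1).comp (continuous_const.add continuous_id)).mul
      ((Real.continuous_rpow_const (sub_nonneg.mpr hα.2)).comp
        (continuous_const.add continuous_id))
  have := hc.tendsto 0
  simp only [add_zero] at this
  exact this.mono_left nhdsWithin_le_nhds

/-- Two `G`-functions satisfying the weighted mixed inequalities force nonsingularity. -/
theorem det_ne_zero_of_rpow_lt (hn : 2 ≤ n) (hg : g ∈ gFunctions n) (hh : h ∈ gFunctions n)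
    (hα : α ∈ Set.Icc (0 : ℝ) 1) {A : Matrix (Fin n) (Fin n) ℂ}
    (hlt : ∀ i j, i ≠ j → g A i ^ α * h A j ^ (1 - α) < ‖A i i‖ ^ α * ‖A j j‖ ^ (1 - α)) :
    A.det ≠ 0 := by
  have : Nontrivial (Fin n) := Fin.nontrivial_iff_two_le.mpr hn
  -- Finitely many strict inequalities survive a small perturbation.
  have hev : ∀ᶠ ε in 𝓝[>] (0 : ℝ), ∀ i j, i ≠ j →
      (g A i + ε) ^ α * (h A j + ε) ^ (1 - α) < ‖A i i‖ ^ α * ‖A j j‖ ^ (1 - α) := by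
    simp only [eventually_all]
    exact fun i j hij => (tendsto_rpow_add_mul hα _ _).eventually_lt_const (hlt i j hij)
  obtain ⟨ε, hε, hpos⟩ := (hev.and self_mem_nhdsWithin).exists
  exact (offDiagDominated_of_mem_gFunctions hg A hpos).det_ne_zero_of_rpow
    (offDiagDominated_of_mem_gFunctions hh A hpos)
    (fun k => add_pos_of_nonneg_of_pos (gFunctions_nonneg hg A k) hpos)
    (fun k => add_pos_of_nonneg_of_pos (gFunctions_nonneg hh A k) hpos) hα hε

lemma gFunctions_mono {f : Matrix (Fin n) (Fin n) ℂ → Fin n → ℝ} (hg : g ∈ gFunctions n)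
    (hf : f ∈ radiusFunctions n) (hle : ∀ A k, g A k ≤ f A k) : f ∈ gFunctions n :=
  ⟨hf, fun A hA => hg.2 A fun k => (hle A k).trans_lt (hA k)⟩

/-- The set of `G`-functions is closed under weighted geometric means. -/
theorem geomMean_mem_gFunctions (hn : 2 ≤ n) (hg : g ∈ gFunctions n) (hh : h ∈ gFunctions n)
    (hα : α ∈ Set.Icc (0 : ℝ) 1) :
    (fun A k => g A k ^ α * h A k ^ (1 - α)) ∈ gFunctions n := by
  have : Nontrivial (Fin n) := Fin.nontrivial_iff_two_le.mpr hn
  refine ⟨⟨fun A k => mul_nonneg (Real.rpow_nonneg (gFunctions_nonneg hg A k) _)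
    (Real.rpow_nonneg (gFunctions_nonneg hh A k) _), fun A B hAB k => ?_⟩, fun A hA => ?_⟩
  · simp only [hg.1.2 A B hAB, hh.1.2 A B hAB]
  have hev : ∀ᶠ ε in 𝓝[>] (0 : ℝ), ∀ k,
      (g A k + ε) ^ α * (h A k + ε) ^ (1 - α) < ‖A k k‖ := by
    simp only [eventually_all]
    exact fun k => (tendsto_rpow_add_mul hα _ _).eventually_lt_const (hA k)
  obtain ⟨ε, hε, hpos⟩ := (hev.and self_mem_nhdsWithin).exists
  have hG : ∀ k, 0 < g A k + ε := fun k =>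
    add_pos_of_nonneg_of_pos (gFunctions_nonneg hg A k) hpos
  have hH : ∀ k, 0 < h A k + ε := fun k =>
    add_pos_of_nonneg_of_pos (gFunctions_nonneg hh A k) hpos
  have hGH : ∀ k, 0 < (g A k + ε) ^ α * (h A k + ε) ^ (1 - α) := fun k =>
    mul_pos (Real.rpow_pos_of_pos (hG k) _) (Real.rpow_pos_of_pos (hH k) _)
  exact ((offDiagDominated_of_mem_gFunctions hg A hpos).rpow_mul_rpow
    (offDiagDominated_of_mem_gFunctions hh A hpos) hG hH hα).det_ne_zero hGH
    fun i j _ => mul_lt_mul'' (hε i) (hε j) (hGH i).le (hGH j).le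

lemma rpow_mul_rpow_le {a b : ℝ} (ha : 0 ≤ a) (hb : 0 ≤ b) (hα : α ∈ Set.Icc (0 : ℝ) 1) :
    a ^ α * b ^ (1 - α) ≤ α * a + (1 - α) * b :=
  Real.geom_mean_le_arith_mean2_weighted hα.1 (sub_nonneg.mpr hα.2) ha hb (by ring)

/-- The set of `G`-functions is closed under weighted arithmetic means. -/
theorem arithMean_mem_gFunctions (hn : 2 ≤ n) (hg : g ∈ gFunctions n) (hh : h ∈ gFunctions n)
    (hα : α ∈ Set.Icc (0 : ℝ) 1) :
    (fun A k => α * g A k + (1 - α) * h A k) ∈ gFunctions n := by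
  refine gFunctions_mono (geomMean_mem_gFunctions hn hg hh hα) ⟨fun A k => ?_, fun A B hAB k => ?_⟩
    fun A k => rpow_mul_rpow_le (gFunctions_nonneg hg A k) (gFunctions_nonneg hh A k) hα
  · exact add_nonneg (mul_nonneg hα.1 (gFunctions_nonneg hg A k))
      (mul_nonneg (sub_nonneg.mpr hα.2) (gFunctions_nonneg hh A k))
  · simp only [hg.1.2 A B hAB, hh.1.2 A B hAB]

/-! ### Regions, and the spectrum in type 15 -/

lemma mem_region_of_le_three {k : ℕ} (hk : k ≤ 3) {A : Matrix (Fin n) (Fin n) ℂ} {z : ℂ} :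
    z ∈ region k A g h α β ↔ ∃ i, z ∈ disk k A g h α i := by
  simp [region, hk]

lemma mem_region_of_four_le {k : ℕ} (hk : 4 ≤ k) {A : Matrix (Fin n) (Fin n) ℂ} {z : ℂ} :
    z ∈ region k A g h α β ↔ ∃ i j, i ≠ j ∧ z ∈ oval k A g h α β i j := by
  simp [region, show ¬ k ≤ 3 by omega]

lemma mem_minimalSet {k : ℕ} {A : Matrix (Fin n) (Fin n) ℂ} {z : ℂ} :
    z ∈ minimalSet k A ↔ ∀ g ∈ gFunctions n, ∀ h ∈ gFunctions n, ∀ α ∈ Set.Icc (0 : ℝ) 1,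
      ∀ β ∈ Set.Icc (0 : ℝ) 1, z ∈ region k A g h α β := by
  simp only [minimalSet, Set.mem_iInter]

theorem spectrum_subset_minimalSet_fifteen (hn : 2 ≤ n) (A : Matrix (Fin n) (Fin n) ℂ) :
    spectrum ℂ A ⊆ minimalSet 15 A := by
  refine fun z hz => mem_minimalSet.mpr fun g hg h hh α hα β _ => ?_
  rw [mem_region_of_four_le (by norm_num)]
  by_contra! hcon
  rw [spectrum.mem_iff, Matrix.isUnit_iff_isUnit_det, isUnit_iff_ne_zero] at hz
  refine hz (det_ne_zero_of_rpow_lt hn hg hh hα fun i j hij => ?_)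
  -- Shifting by a scalar matrix leaves the radii unchanged.
  have hoff : ∀ i j, i ≠ j → ‖(algebraMap ℂ (Matrix (Fin n) (Fin n) ℂ) z - A) i j‖ = ‖A i j‖ :=
    fun i j hij => by simp [Matrix.algebraMap_matrix_apply, hij]
  rw [hg.1.2 _ A hoff, hh.1.2 _ A hoff]
  simpa [oval, ovalRadius, Matrix.algebraMap_matrix_apply] using hcon i j hij

/-! ### Reduction of all types to type 15 -/

section Regions

variable {A : Matrix (Fin n) (Fin n) ℂ} {z : ℂ}

lemma exists_rpow_le_of_mem_minimalSet (hz : z ∈ minimalSet 15 A) (hg : g ∈ gFunctions n)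
    (hh : h ∈ gFunctions n) (hα : α ∈ Set.Icc (0 : ℝ) 1) :
    ∃ i j, i ≠ j ∧
      ‖z - A i i‖ ^ α * ‖z - A j j‖ ^ (1 - α) ≤ g A i ^ α * h A j ^ (1 - α) := by
  have := mem_minimalSet.mp hz g hg h hh α hα 0 (by simp)
  rw [mem_region_of_four_le (by norm_num)] at this
  simpa [oval, ovalRadius] using this

lemma exists_le_of_mem_minimalSet (hz : z ∈ minimalSet 15 A) (hg : g ∈ gFunctions n) :
    ∃ i, ‖z - A i i‖ ≤ g A i := by
  obtain ⟨i, j, -, hij⟩ := exists_rpow_le_of_mem_minimalSet hz hg hg (α := 1) (by simp)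
  exact ⟨i, by simpa using hij⟩

/-- At `α = 1 / 2` the type 15 inequality is the square root of the Cassini inequality. -/
lemma exists_mul_le_of_mem_minimalSet (hz : z ∈ minimalSet 15 A) (hg : g ∈ gFunctions n)
    (hh : h ∈ gFunctions n) :
    ∃ i j, i ≠ j ∧ ‖z - A i i‖ * ‖z - A j j‖ ≤ g A i * h A j := by
  obtain ⟨i, j, hne, hij⟩ :=
    exists_rpow_le_of_mem_minimalSet hz hg hh (α := 1 / 2) (by norm_num)
  refine ⟨i, j, hne, ?_⟩
  have hgi := gFunctions_nonneg hg A i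
  have hhj := gFunctions_nonneg hh A j
  rw [show (1 : ℝ) - 1 / 2 = 1 / 2 by norm_num, ← Real.mul_rpow (norm_nonneg _) (norm_nonneg _),
    ← Real.mul_rpow hgi hhj] at hij
  exact (Real.rpow_le_rpow_iff (by positivity) (mul_nonneg hgi hhj) (by norm_num)).mp hij

/-- Interchanges the mean over `g`, `h` with the mean over the indices, so that AM-GM can be applied
in the other order. -/
lemma rpow_rearrange {a b c d : ℝ} (ha : 0 ≤ a) (hb : 0 ≤ b) (hc : 0 ≤ c) (hd : 0 ≤ d) :
    (a ^ β * b ^ (1 - β)) ^ α * (c ^ β * d ^ (1 - β)) ^ (1 - α) =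
      (a ^ α * c ^ (1 - α)) ^ β * (b ^ α * d ^ (1 - α)) ^ (1 - β) := by
  have hr : ∀ {x : ℝ}, 0 ≤ x → ∀ s t : ℝ, (x ^ s) ^ t = (x ^ t) ^ s := fun hx s t => by
    rw [← Real.rpow_mul hx, ← Real.rpow_mul hx, mul_comm]
  rw [Real.mul_rpow (Real.rpow_nonneg ha _) (Real.rpow_nonneg hb _),
    Real.mul_rpow (Real.rpow_nonneg hc _) (Real.rpow_nonneg hd _),
    Real.mul_rpow (Real.rpow_nonneg ha _) (Real.rpow_nonneg hc _),
    Real.mul_rpow (Real.rpow_nonneg hb _) (Real.rpow_nonneg hd _),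
    hr ha, hr hb, hr hc, hr hd]
  ring

/-- The minimal set of type `15` lies in every region. -/
theorem minimalSet_fifteen_subset_region (hn : 2 ≤ n) {k : ℕ} (hk : k ∈ Finset.Icc 1 27)
    (hg : g ∈ gFunctions n) (hh : h ∈ gFunctions n) (hα : α ∈ Set.Icc (0 : ℝ) 1)
    (hβ : β ∈ Set.Icc (0 : ℝ) 1) : minimalSet 15 A ⊆ region k A g h α β := by
  intro z hz
  have g0 := gFunctions_nonneg hg A
  have h0 := gFunctions_nonneg hh A
  have hα1 := sub_nonneg.mpr hα.2
  have hβ1 := sub_nonneg.mpr hβ.2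
  have hGα := geomMean_mem_gFunctions hn hg hh hα
  have hGα' := geomMean_mem_gFunctions hn hh hg hα
  have hGβ := geomMean_mem_gFunctions hn hg hh hβ
  have hGβ' := geomMean_mem_gFunctions hn hh hg hβ
  have hMα := arithMean_mem_gFunctions hn hg hh hα
  have hMα' := arithMean_mem_gFunctions hn hh hg hα
  have hMβ := arithMean_mem_gFunctions hn hg hh hβ
  have hMβ' := arithMean_mem_gFunctions hn hh hg hβ
  have of_disk : ∀ f ∈ gFunctions n, k ≤ 3 → (∀ i, f A i ≤ diskRadius k (g A) (h A) α i) →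
      z ∈ region k A g h α β := by
    intro f hf hk3 hle
    obtain ⟨i, hi⟩ := exists_le_of_mem_minimalSet hz hf
    exact (mem_region_of_le_three hk3).mpr ⟨i, hi.trans (hle i)⟩
  have of_mul : ∀ f ∈ gFunctions n, ∀ e ∈ gFunctions n, 4 ≤ k → k ≤ 13 →
      (∀ i j, f A i * e A j ≤ ovalRadius k (g A) (h A) α β i j) →
      z ∈ region k A g h α β := by
    intro f hf e he hk4 hk13 hle
    obtain ⟨i, j, hne, hij⟩ := exists_mul_le_of_mem_minimalSet hz hf he
    refine (mem_region_of_four_le hk4).mpr ⟨i, j, hne, ?_⟩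
    rw [oval, if_pos hk13]
    exact hij.trans (hle i j)
  have of_rpow : ∀ f ∈ gFunctions n, ∀ e ∈ gFunctions n, 14 ≤ k →
      (∀ i j, f A i ^ α * e A j ^ (1 - α) ≤ ovalRadius k (g A) (h A) α β i j) →
      z ∈ region k A g h α β := by
    intro f hf e he hk14 hle
    obtain ⟨i, j, hne, hij⟩ := exists_rpow_le_of_mem_minimalSet hz hf he hα
    refine (mem_region_of_four_le (by omega)).mpr ⟨i, j, hne, ?_⟩
    rw [oval, if_neg (by omega)]
    exact hij.trans (hle i j)
  have amgm : ∀ {t : ℝ}, t ∈ Set.Icc (0 : ℝ) 1 → ∀ {a b : ℝ}, 0 ≤ a → 0 ≤ b →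
      a ^ t * b ^ (1 - t) ≤ t * a + (1 - t) * b := fun ht _ _ ha hb => rpow_mul_rpow_le ha hb ht
  have gm0 : ∀ {t : ℝ} {a b : ℝ}, 0 ≤ a → 0 ≤ b → 0 ≤ a ^ t * b ^ (1 - t) := fun ha hb =>
    mul_nonneg (Real.rpow_nonneg ha _) (Real.rpow_nonneg hb _)
  have split : ∀ {a b c d : ℝ}, 0 ≤ a → 0 ≤ b → 0 ≤ c → 0 ≤ d →
      (a ^ α * b ^ (1 - α)) * (c ^ α * d ^ (1 - α)) = (a * c) ^ α * (b * d) ^ (1 - α) :=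
    fun ha hb hc hd => by rw [Real.mul_rpow ha hc, Real.mul_rpow hb hd]; ring
  have mulle : ∀ {a b c d : ℝ}, 0 ≤ a → 0 ≤ b → 0 ≤ c → 0 ≤ d →
      (a ^ α * b ^ (1 - α)) * (c ^ α * d ^ (1 - α)) ≤
        (α * a + (1 - α) * b) * (α * c + (1 - α) * d) := fun ha hb hc hd =>
    mul_le_mul (amgm hα ha hb) (amgm hα hc hd) (gm0 hc hd) ((gm0 ha hb).trans (amgm hα ha hb))
  obtain ⟨hk1, hk27⟩ := Finset.mem_Icc.mp hk
  interval_cases k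
  · exact of_disk g hg (by norm_num) fun i => le_rfl
  · exact of_disk _ hGα (by norm_num) fun i => le_rfl
  · exact of_disk _ hMα (by norm_num) fun i => le_rfl
  · exact of_mul g hg g hg (by norm_num) (by norm_num) fun i j => le_rfl
  · exact of_mul g hg h hh (by norm_num) (by norm_num) fun i j => le_rfl
  · exact of_mul _ hGα _ hGα (by norm_num) (by norm_num) fun i j =>
      (split (g0 i) (h0 i) (g0 j) (h0 j)).le
  · refine of_mul _ hGα _ hGα' (by norm_num) (by norm_num) fun i j =>
      (split (g0 i) (h0 i) (h0 j) (g0 j)).trans_le ?_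
    rw [mul_comm (h A i)]; exact le_rfl
  · exact of_mul _ hGα _ hGα (by norm_num) (by norm_num) fun i j =>
      (split (g0 i) (h0 i) (g0 j) (h0 j)).trans_le
        (amgm hα (mul_nonneg (g0 i) (g0 j)) (mul_nonneg (h0 i) (h0 j)))
  · refine of_mul _ hGα _ hGα' (by norm_num) (by norm_num) fun i j =>
      (split (g0 i) (h0 i) (h0 j) (g0 j)).trans_le ?_
    rw [mul_comm (h A i)]
    exact amgm hα (mul_nonneg (g0 i) (h0 j)) (mul_nonneg (g0 j) (h0 i))
  · exact of_mul _ hMα _ hMα (by norm_num) (by norm_num) fun i j => le_rfl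
  · exact of_mul _ hMα _ hMα' (by norm_num) (by norm_num) fun i j => le_rfl
  -- The factors of types 12 and 13 mix indices and are not values of `G`-functions. Only the
  -- product matters: regroup the geometric means first, then apply AM-GM to each new factor.
  · refine of_mul _ hGα _ hGα (by norm_num) (by norm_num) fun i j => ?_
    refine Eq.trans_le ?_ (mulle (g0 i) (h0 j) (g0 j) (h0 i))
    ring
  · refine of_mul _ hGα _ hGα' (by norm_num) (by norm_num) fun i j => ?_
    refine Eq.trans_le ?_ (mulle (g0 i) (g0 j) (h0 j) (h0 i))
    ring
  · exact of_rpow g hg g hg (by norm_num) fun i j => le_rfl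
  · exact of_rpow g hg h hh (by norm_num) fun i j => le_rfl
  · exact of_rpow g hg g hg (by norm_num) fun i j => amgm hα (g0 i) (g0 j)
  · exact of_rpow g hg h hh (by norm_num) fun i j => amgm hα (g0 i) (h0 j)
  · exact of_rpow _ hGβ _ hGβ (by norm_num) fun i j => le_rfl
  · exact of_rpow _ hGβ _ hGβ' (by norm_num) fun i j => le_rfl
  · exact of_rpow _ hGβ _ hGβ (by norm_num) fun i j =>
      (rpow_rearrange (g0 i) (h0 i) (g0 j) (h0 j)).trans_le
        (amgm hβ (gm0 (g0 i) (g0 j)) (gm0 (h0 i) (h0 j)))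
  · exact of_rpow _ hGβ _ hGβ' (by norm_num) fun i j =>
      (rpow_rearrange (g0 i) (h0 i) (h0 j) (g0 j)).trans_le
        (amgm hβ (gm0 (g0 i) (h0 j)) (gm0 (h0 i) (g0 j)))
  · exact of_rpow _ hGβ _ hGβ (by norm_num) fun i j =>
      amgm hα (gm0 (g0 i) (h0 i)) (gm0 (g0 j) (h0 j))
  · exact of_rpow _ hGβ _ hGβ' (by norm_num) fun i j =>
      amgm hα (gm0 (g0 i) (h0 i)) (gm0 (h0 j) (g0 j))
  · exact of_rpow _ hMβ _ hMβ (by norm_num) fun i j => le_rfl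
  · exact of_rpow _ hMβ _ hMβ' (by norm_num) fun i j => le_rfl
  -- Likewise for types 26 and 27: rearrange, then apply AM-GM over the indices inside each power.
  · exact of_rpow _ hGβ _ hGβ (by norm_num) fun i j =>
      (rpow_rearrange (g0 i) (h0 i) (g0 j) (h0 j)).trans_le
        (mul_le_mul (Real.rpow_le_rpow (gm0 (g0 i) (g0 j)) (amgm hα (g0 i) (g0 j)) hβ.1)
          (Real.rpow_le_rpow (gm0 (h0 i) (h0 j)) (amgm hα (h0 i) (h0 j)) hβ1)
          (Real.rpow_nonneg (gm0 (h0 i) (h0 j)) _)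
          (Real.rpow_nonneg ((gm0 (g0 i) (g0 j)).trans (amgm hα (g0 i) (g0 j))) _))
  · exact of_rpow _ hGβ _ hGβ' (by norm_num) fun i j =>
      (rpow_rearrange (g0 i) (h0 i) (h0 j) (g0 j)).trans_le
        (mul_le_mul (Real.rpow_le_rpow (gm0 (g0 i) (h0 j)) (amgm hα (g0 i) (h0 j)) hβ.1)
          (Real.rpow_le_rpow (gm0 (h0 i) (g0 j)) (amgm hα (h0 i) (g0 j)) hβ1)
          (Real.rpow_nonneg (gm0 (h0 i) (g0 j)) _)
          (Real.rpow_nonneg ((gm0 (g0 i) (h0 j)).trans (amgm hα (g0 i) (h0 j))) _))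

end Regions

end GFunction

theorem theorem5p3 (n : ℕ) (hn : 2 ≤ n) (A : Matrix (Fin n) (Fin n) ℂ) :
    -- (a)
    (∀ g ∈ GFunction.gFunctions n, ∀ h ∈ GFunction.gFunctions n,
      ∀ α ∈ Set.Icc (0 : ℝ) 1, ∀ β ∈ Set.Icc (0 : ℝ) 1, ∀ z ∈ spectrum ℂ A,
        (∀ k ∈ Finset.Icc 1 3, ∃ i : Fin n, z ∈ GFunction.disk k A g h α i) ∧
        (∀ k ∈ Finset.Icc 4 27, ∃ i j : Fin n, i ≠ j ∧ z ∈ GFunction.oval k A g h α β i j)) ∧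
    -- (b)
    (∀ k ∈ Finset.Icc 1 27,
      spectrum ℂ A ⊆ GFunction.minimalSet k A ∧
      ∀ g ∈ GFunction.gFunctions n, ∀ h ∈ GFunction.gFunctions n,
        ∀ α ∈ Set.Icc (0 : ℝ) 1, ∀ β ∈ Set.Icc (0 : ℝ) 1,
          GFunction.minimalSet k A ⊆ GFunction.region k A g h α β) ∧
    -- (c)
    (spectrum ℂ A ⊆ ⋂ k ∈ Finset.Icc 1 27, GFunction.minimalSet k A) ∧
    (⋂ k ∈ Finset.Icc 1 27, GFunction.minimalSet k A) = GFunction.minimalSet 15 A := by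
  have hsub : ∀ k ∈ Finset.Icc 1 27, GFunction.minimalSet 15 A ⊆ GFunction.minimalSet k A :=
    fun k hk z hz => GFunction.mem_minimalSet.mpr fun g hg h hh α hα β hβ =>
      GFunction.minimalSet_fifteen_subset_region hn hk hg hh hα hβ hz
  have hspec := GFunction.spectrum_subset_minimalSet_fifteen hn A
  refine ⟨fun g hg h hh α hα β hβ z hz => ⟨fun k hk => ?_, fun k hk => ?_⟩,
    fun k hk => ⟨hspec.trans (hsub k hk), fun g hg h hh α hα β hβ z hz =>
      GFunction.mem_minimalSet.mp hz g hg h hh α hα β hβ⟩,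
    Set.subset_iInter₂ fun k hk => hspec.trans (hsub k hk),
    (Set.iInter₂_subset 15 (by simp)).antisymm (Set.subset_iInter₂ hsub)⟩
  · rw [Finset.mem_Icc] at hk
    exact (GFunction.mem_region_of_le_three hk.2).mp
      (GFunction.minimalSet_fifteen_subset_region hn (Finset.mem_Icc.mpr ⟨hk.1, by omega⟩)
        hg hh hα hβ (hspec hz))
  · rw [Finset.mem_Icc] at hk
    exact (GFunction.mem_region_of_four_le hk.1).mp
      (GFunction.minimalSet_fifteen_subset_region hn (Finset.mem_Icc.mpr ⟨by omega, hk.2⟩)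
        hg hh hα hβ (hspec hz))
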